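/- A finite graph $G$ is an interval graph if there are nonempty intervals $(I_v)_{v\in V(G)}$ of real numbers such that, for all $v\ne w$, $vw\in E(G)$ if and only if $I_v\cap I_w\neq\emptyset$. For finite simple graphs $F,G$ let $t(F,G)$ be the probability that a uniformly random map $V(F)\to V(G)$ is a graph homomorphism. A graph limit $\Gamma$ is determined by the numbers $t(F,\Gamma)$, $F$ a finite graph: $G_n\to\Gamma$ means that $|G_n|\to\infty$ and $t(F,G_n)\to t(F,\Gamma)$ for every $F$, and the space $\mathcal U_\infty$ consists of all limits $\Gamma$ of sequences of finite graphs, with the topology of convergence of $t(F,\cdot)$ for every $F$. Let $\mathcal I_\infty\subset\mathcal U_\infty$ be the set of interval graph limits, i.e. the limits of sequences of interval graphs. Let $\mathcal S=\{[a,b]:0\le a\le b\le 1\}$, identified with a closed triangle in the plane, let $W(I,J)=\mathbf 1\{I\cap J\ne\emptyset\}$ for $I,J\in\mathcal S$, and let $\mathcal P(\mathcal S)$ be the set of Borel probability measures on $\mathcal S$ with the topology of weak convergence. For $\mu\in\mathcal P(\mathcal S)$ let $\Gamma_\mu$ be given by $$t(F,\Gamma_\mu)=\int_{\mathcal S^{|F|}}\prod_{ij\in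 E(F)}W(x_i,x_j)\,d\mu(x_1)\cdots d\mu(x_{|F|})\quad\text{for every finite graph }F,$$ and let $\mu_L,\mu_R$ be the images of $\mu$ under $[a,b]\mapsto a$ and $[a,b]\mapsto b$. With $\lambda$ Lebesgue measure on $[0,1]$, put $$\mathcal P_L=\{\mu:\mu_L=\lambda\},\qquad \mathcal P_R=\{\mu:\mu_R=\lambda\},\qquad \mathcal P_m=\{\mu:\tfrac12(\mu_L+\mu_R)=\lambda\}.$$ **Theorem.** $$\mathcal I_\infty=\{\Gamma_\mu:\mu\in\mathcal P(\mathcal S)\}=\{\Gamma_\mu:\mu\in\mathcal P_L\}=\{\Gamma_\mu:\mu\in\mathcal P_R\}=\{\Gamma_\mu:\mu\in\mathcal P_m\}.$$ In particular each $\Gamma_\mu$ is a graph limit. Moreover, the map $\mu\mapsto\Gamma_\mu$ is a continuous map of each of $\mathcal P_L$, $\mathcal P_R$ and $\mathcal P_m$ onto $\mathcal I_\infty$. -/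

import Mathlib

open MeasureTheory Filter Topology

noncomputable section

namespace IntervalGraphLimits

/-- Finite simple graphs, up to isomorphism (every finite graph is isomorphic to one
with vertex set `Fin n`). -/
structure FinGraph where
  order : ℕ
  graph : SimpleGraph (Fin order)

/-- `t(F, G)`: the probability that a uniformly random map `V(F) → V(G)` (one of the
`|G| ^ |F|` possible ones) is a graph homomorphism. -/
def homDensity (F G : FinGraph) : ℝ :=
  (Nat.card (F.graph →g G.graph) : ℝ) / (G.order : ℝ) ^ F.order

/-- Families of real numbers indexed by finite graphs, with the product topology
(pointwise convergence). A graph limit `Γ` is identified with the family `F ↦ t(F, Γ)`,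
which determines it; the topology on graph limits is that of convergence of
`t(F, ·)` for every `F`. -/
abbrev GraphParameter : Type := FinGraph → ℝ

/-- `G n → Γ`: the orders tend to infinity and `t(F, G n) → t(F, Γ)` for every `F`. -/
def ConvergesTo (G : ℕ → FinGraph) (Γ : GraphParameter) : Prop :=
  Tendsto (fun n => (G n).order) atTop atTop ∧
    ∀ F : FinGraph, Tendsto (fun n => homDensity F (G n)) atTop (𝓝 (Γ F))

/-- The set `𝓤_∞` of (proper) graph limits. -/
def graphLimits : Set GraphParameter :=
  {Γ | ∃ G : ℕ → FinGraph, ConvergesTo G Γ}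

/-- A graph is an interval graph if there are (nonempty, otherwise arbitrary) real intervals
`I v` such that distinct `v`, `w` are adjacent exactly when `I v` and `I w` meet. -/
def IsIntervalGraph (G : FinGraph) : Prop :=
  ∃ I : Fin G.order → Set ℝ,
    (∀ v, (I v).OrdConnected ∧ (I v).Nonempty) ∧
    ∀ v w, v ≠ w → (G.graph.Adj v w ↔ (I v ∩ I w).Nonempty)

/-- The set `𝓘_∞` of interval graph limits: the graph limits that are limits of
sequences of interval graphs. -/
def intervalGraphLimits : Set GraphParameter :=
  {Γ | Γ ∈ graphLimits ∧ ∃ G : ℕ → FinGraph, (∀ n, IsIntervalGraph (G n)) ∧ ConvergesTo G Γ}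

open Classical in
/-- The density `∫ ∏_{ij ∈ E(F)} W (x_i, x_j) dμ(x_1) ⋯ dμ(x_k)` of `F` in a symmetric
kernel `W` on `(S, μ)`; each edge `ij` is counted once, with `i < j`. -/
def kernelDensity {S : Type*} [MeasurableSpace S] (μ : Measure S) (W : S → S → ℝ)
    (F : FinGraph) : ℝ :=
  ∫ x : Fin F.order → S,
    ∏ e : Fin F.order × Fin F.order with e.1 < e.2 ∧ F.graph.Adj e.1 e.2, W (x e.1) (x e.2)
    ∂(Measure.pi fun _ => μ)

/-- The space `𝓢` of closed intervals `[a, b]` with `0 ≤ a ≤ b ≤ 1`, as a closed triangle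
in the plane, with the topology and Borel σ-algebra inherited from the plane. -/
abbrev IntervalSpace : Type := {p : unitInterval × unitInterval // p.1 ≤ p.2}

/-- The left endpoint `[a, b] ↦ a`. -/
def leftEnd (I : IntervalSpace) : unitInterval := I.1.1

/-- The right endpoint `[a, b] ↦ b`. -/
def rightEnd (I : IntervalSpace) : unitInterval := I.1.2

/-- The set of points of the interval. -/
def toSet (I : IntervalSpace) : Set unitInterval := Set.Icc (leftEnd I) (rightEnd I)

open Classical in
/-- The kernel `W(I, J) = 1{I ∩ J ≠ ∅}`. -/
def overlapKernel (I J : IntervalSpace) : ℝ :=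
  if (toSet I ∩ toSet J).Nonempty then 1 else 0

/-- `Γ_μ`, given by its densities `t(F, Γ_μ)`. -/
def limitOf (μ : ProbabilityMeasure IntervalSpace) : GraphParameter :=
  fun F => kernelDensity (μ : Measure IntervalSpace) overlapKernel F

/-- `μ_L`, the distribution of the left endpoint. -/
def leftMarginal (μ : ProbabilityMeasure IntervalSpace) : Measure unitInterval :=
  (μ : Measure IntervalSpace).map leftEnd

/-- `μ_R`, the distribution of the right endpoint. -/
def rightMarginal (μ : ProbabilityMeasure IntervalSpace) : Measure unitInterval :=
  (μ : Measure IntervalSpace).map rightEnd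

/-- `𝓟_L(𝓢)`: the left marginal is Lebesgue measure on `[0, 1]`. -/
def leftUniform : Set (ProbabilityMeasure IntervalSpace) :=
  {μ | leftMarginal μ = volume}

/-- `𝓟_R(𝓢)`: the right marginal is Lebesgue measure on `[0, 1]`. -/
def rightUniform : Set (ProbabilityMeasure IntervalSpace) :=
  {μ | rightMarginal μ = volume}

/-- `𝓟_m(𝓢)`: the average of the marginals is Lebesgue measure on `[0, 1]`. -/
def meanUniform : Set (ProbabilityMeasure IntervalSpace) :=
  {μ | (2⁻¹ : ENNReal) • (leftMarginal μ + rightMarginal μ) = volume}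

end IntervalGraphLimits

end

noncomputable section

namespace IntervalGraphLimits

/-! The density of `F` in `Γ_μ` is the mass that the product power of `μ` gives to the closed set
`meetSet F`. On the frontier of this set, the left endpoint of one interval equals the right
endpoint of another. By Fubini that event is null as soon as one marginal of `μ` has no atoms, so
the portmanteau theorem makes `limitOf` continuous at every such `μ`, in particular at every point
of the three normalized classes (`continuousAt_limitOf`).

Each `Γ_μ` is an interval graph limit because the intersection graphs of independent samples from
`μ` have densities with the right mean and vanishing variance. Since there are countably many `F`, a
diagonal choice of samples converges for all of them (`limitOf_mem_intervalGraphLimits`).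

Conversely, adjacency in an interval graph depends only on the order of the endpoints. These can be
made distinct and replaced by their ranks, rescaled to [0,1], so that the left endpoints, the right
endpoints, or all of them together become equally spaced. Compactness gives a limit point `μ` of the
empirical measures, and equal spacing forces the chosen normalization on `μ`. The empirical measures
are atomic, but continuity is needed only at `μ`, where it identifies the limit as `Γ_μ`
(`exists_limitOf_eq`). -/

/-! ### The overlap relation -/

/-- Two intervals of `𝓢` meet. -/
def Meet (I J : IntervalSpace) : Prop :=
  leftEnd I ≤ rightEnd J ∧ leftEnd J ≤ rightEnd I

lemma Meet.symm {I J : IntervalSpace} (h : Meet I J) : Meet J I := ⟨h.2, h.1⟩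

lemma leftEnd_le_rightEnd (I : IntervalSpace) : leftEnd I ≤ rightEnd I := I.2

lemma continuous_leftEnd : Continuous leftEnd := continuous_fst.comp continuous_subtype_val

lemma continuous_rightEnd : Continuous rightEnd := continuous_snd.comp continuous_subtype_val

lemma toSet_inter_nonempty_iff (I J : IntervalSpace) :
    (toSet I ∩ toSet J).Nonempty ↔ Meet I J := by
  have hI := leftEnd_le_rightEnd I
  have hJ := leftEnd_le_rightEnd J
  simp only [toSet, Set.Icc_inter_Icc, Set.nonempty_Icc, Meet, sup_le_iff, le_inf_iff]
  tauto

open Classical in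
lemma overlapKernel_eq (I J : IntervalSpace) :
    overlapKernel I J = if Meet I J then 1 else 0 := by
  simp only [overlapKernel, toSet_inter_nonempty_iff]

instance : CompactSpace IntervalSpace :=
  isCompact_iff_compactSpace.mp (isClosed_le continuous_fst continuous_snd).isCompact

/-- The families of intervals whose members meet along every edge of `F`. -/
def meetSet (F : FinGraph) : Set (Fin F.order → IntervalSpace) :=
  {x | ∀ i j, i < j → F.graph.Adj i j → Meet (x i) (x j)}

lemma mem_meetSet_iff {F : FinGraph} {x : Fin F.order → IntervalSpace} :
    x ∈ meetSet F ↔ ∀ i j, F.graph.Adj i j → Meet (x i) (x j) := by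
  refine ⟨fun h i j hij => ?_, fun h i j _ hij => h i j hij⟩
  rcases lt_or_gt_of_ne hij.ne with hlt | hlt
  · exact h i j hlt hij
  · exact (h j i hlt hij.symm).symm

lemma isClosed_meetSet (F : FinGraph) : IsClosed (meetSet F) := by
  simp only [meetSet, Set.ofPred_forall, Meet, Set.ofPred_and]
  refine isClosed_iInter fun i => isClosed_iInter fun j => isClosed_iInter fun _ =>
    isClosed_iInter fun _ => IsClosed.inter ?_ ?_
  · exact isClosed_le (continuous_leftEnd.comp (continuous_apply i))
      (continuous_rightEnd.comp (continuous_apply j))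
  · exact isClosed_le (continuous_leftEnd.comp (continuous_apply j))
      (continuous_rightEnd.comp (continuous_apply i))

lemma prod_overlapKernel (F : FinGraph) (x : Fin F.order → IntervalSpace)
    [DecidablePred fun e : Fin F.order × Fin F.order => e.1 < e.2 ∧ F.graph.Adj e.1 e.2] :
    ∏ e : Fin F.order × Fin F.order with e.1 < e.2 ∧ F.graph.Adj e.1 e.2,
      overlapKernel (x e.1) (x e.2) = (meetSet F).indicator 1 x := by
  classical
  simp only [overlapKernel_eq, Finset.prod_boole, Set.indicator_apply, Pi.one_apply]
  congr 1
  simp [meetSet]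

lemma limitOf_apply (μ : ProbabilityMeasure IntervalSpace) (F : FinGraph) :
    limitOf μ F =
      (Measure.pi fun _ : Fin F.order => (μ : Measure IntervalSpace)).real (meetSet F) := by
  simp only [limitOf, kernelDensity, prod_overlapKernel]
  exact integral_indicator_one (isClosed_meetSet F).measurableSet

/-! ### Continuity of `μ ↦ Γ_μ` -/

/-- Distinct coordinates of an i.i.d. family are again i.i.d.: the preimage of a box is a box whose
sides off the range of `φ` are the whole space and contribute factors 1. -/
lemma measurePreserving_comp_injective {ι κ S : Type*} [Fintype ι] [Fintype κ]
    [MeasurableSpace S] (μ : Measure S) [IsProbabilityMeasure μ] {φ : ι → κ}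
    (hφ : Function.Injective φ) :
    MeasurePreserving (fun x : κ → S => x ∘ φ) (Measure.pi fun _ => μ)
      (Measure.pi fun _ => μ) := by
  have hm : Measurable (fun x : κ → S => x ∘ φ) := by
    refine measurable_pi_lambda _ fun i => measurable_pi_apply (φ i)
  refine ⟨hm, (Measure.pi_eq fun s hs => ?_).symm⟩
  rw [Measure.map_apply hm (MeasurableSet.univ_pi hs)]
  have : (fun x : κ → S => x ∘ φ) ⁻¹' Set.univ.pi s =
      Set.univ.pi (Function.extend φ s fun _ => Set.univ) := by
    ext x
    simp only [Set.mem_preimage, Set.mem_pi, Set.mem_univ, true_implies, Function.comp_apply]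
    constructor
    · intro h k
      by_cases hk : ∃ i, φ i = k
      · obtain ⟨i, rfl⟩ := hk
        rw [hφ.extend_apply]
        exact h i
      · rw [Function.extend_apply' _ _ _ hk]
        trivial
    · intro h i
      simpa only [hφ.extend_apply] using h (φ i)
  rw [this, Measure.pi_pi]
  symm
  refine Fintype.prod_of_injective φ hφ _ _ (fun k hk => ?_) fun i => ?_
  · rw [Function.extend_apply' _ _ _ (by simpa using hk), measure_univ]
  · rw [hφ.extend_apply]

lemma pi_setOf_pair_eq_zero {ι S : Type*} [Fintype ι] [MeasurableSpace S] (μ : Measure S)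
    [IsProbabilityMeasure μ] {i j : ι} (hij : i ≠ j) {A : Set (S × S)} (hA : MeasurableSet A)
    (h : ∀ s, μ {t | (s, t) ∈ A} = 0) :
    (Measure.pi fun _ : ι => μ) {x | (x i, x j) ∈ A} = 0 := by
  have hinj : Function.Injective ![i, j] := by
    intro a b
    fin_cases a <;> fin_cases b <;> simp [hij, hij.symm]
  have h1 := measurePreserving_comp_injective μ hinj
  have h2 := (measurePreserving_piFinTwo fun _ : Fin 2 => μ).comp h1
  have h3 := h2.measure_preimage hA.nullMeasurableSet
  have h4 : (μ.prod μ) A = 0 := by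
    rw [Measure.measure_prod_null hA]
    exact ae_of_all _ h
  rw [← h4, ← h3]
  rfl

/-- Fubini: once the other interval is fixed, the endpoint with the atomless distribution would have
to hit a prescribed point. -/
lemma pi_leftEnd_eq_rightEnd (μ : ProbabilityMeasure IntervalSpace)
    (h : (∀ t, leftMarginal μ {t} = 0) ∨ ∀ t, rightMarginal μ {t} = 0)
    {ι : Type*} [Fintype ι] {i j : ι} (hij : i ≠ j) :
    (Measure.pi fun _ : ι => (μ : Measure IntervalSpace))
      {x | leftEnd (x i) = rightEnd (x j)} = 0 := by
  rcases h with h | h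
  · refine pi_setOf_pair_eq_zero (μ : Measure IntervalSpace) hij.symm
      (A := {p | leftEnd p.2 = rightEnd p.1}) ?_ fun s => ?_
    · exact (isClosed_eq (continuous_leftEnd.comp continuous_snd)
        (continuous_rightEnd.comp continuous_fst)).measurableSet
    · rw [← h (rightEnd s), leftMarginal,
        Measure.map_apply continuous_leftEnd.measurable (measurableSet_singleton _)]
      rfl
  · refine pi_setOf_pair_eq_zero (μ : Measure IntervalSpace) hij
      (A := {p | leftEnd p.1 = rightEnd p.2}) ?_ fun s => ?_
    · exact (isClosed_eq (continuous_leftEnd.comp continuous_fst)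
        (continuous_rightEnd.comp continuous_snd)).measurableSet
    · rw [← h (leftEnd s), rightMarginal,
        Measure.map_apply continuous_rightEnd.measurable (measurableSet_singleton _)]
      congr 1
      ext t
      exact eq_comm

/-- Away from these coincidences all the defining inequalities are strict, hence stable under
perturbation. Only pairs of distinct indices occur, so degenerate intervals do no harm. -/
lemma frontier_meetSet_subset (F : FinGraph) :
    frontier (meetSet F) ⊆
      ⋃ p : {p : Fin F.order × Fin F.order // p.1 ≠ p.2},
        {x | leftEnd (x p.1.1) = rightEnd (x p.1.2)} := by
  intro x hx
  rw [(isClosed_meetSet F).frontier_eq] at hx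
  by_contra hne
  simp only [Set.mem_iUnion, not_exists] at hne
  have hne' : ∀ i j, i ≠ j → leftEnd (x i) ≠ rightEnd (x j) := fun i j hij => hne ⟨(i, j), hij⟩
  apply hx.2
  let U : Set (Fin F.order → IntervalSpace) := ⋂ i, ⋂ j, ⋂ _ : i < j, ⋂ _ : F.graph.Adj i j,
    {x | leftEnd (x i) < rightEnd (x j)} ∩ {x | leftEnd (x j) < rightEnd (x i)}
  have hU : IsOpen U := by
    refine isOpen_iInter_of_finite fun i => isOpen_iInter_of_finite fun j =>
      isOpen_iInter_of_finite fun _ => isOpen_iInter_of_finite fun _ => IsOpen.inter ?_ ?_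
    · exact isOpen_lt (continuous_leftEnd.comp (continuous_apply i))
        (continuous_rightEnd.comp (continuous_apply j))
    · exact isOpen_lt (continuous_leftEnd.comp (continuous_apply j))
        (continuous_rightEnd.comp (continuous_apply i))
  refine mem_interior.2 ⟨U, fun y hy i j hij hadj => ?_, hU, ?_⟩
  · simp only [U, Set.mem_iInter] at hy
    exact ⟨(hy i j hij hadj).1.le, (hy i j hij hadj).2.le⟩
  · simp only [U, Set.mem_iInter]
    intro i j hij hadj
    exact ⟨lt_of_le_of_ne (hx.1 i j hij hadj).1 (hne' i j hij.ne),
      lt_of_le_of_ne (hx.1 i j hij hadj).2 (hne' j i hij.ne')⟩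

lemma continuousAt_limitOf (μ : ProbabilityMeasure IntervalSpace)
    (h : (∀ t, leftMarginal μ {t} = 0) ∨ ∀ t, rightMarginal μ {t} = 0) :
    ContinuousAt limitOf μ := by
  refine tendsto_pi_nhds.2 fun F => ?_
  have hpi : Tendsto (fun ν : ProbabilityMeasure IntervalSpace =>
      ProbabilityMeasure.pi fun _ : Fin F.order => ν) (𝓝 μ)
      (𝓝 (ProbabilityMeasure.pi fun _ : Fin F.order => μ)) :=
    (ProbabilityMeasure.continuous_pi.comp
      (continuous_pi fun _ : Fin F.order => continuous_id)).tendsto μ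
  have hnull : (ProbabilityMeasure.pi fun _ : Fin F.order => μ) (frontier (meetSet F)) = 0 := by
    rw [ProbabilityMeasure.null_iff_toMeasure_null]
    refine measure_mono_null (frontier_meetSet_subset F) (measure_iUnion_null fun p => ?_)
    exact pi_leftEnd_eq_rightEnd μ h p.2
  have := ProbabilityMeasure.tendsto_measure_of_null_frontier_of_tendsto hpi hnull
  have := NNReal.tendsto_coe.2 this
  simp only [limitOf_apply]
  exact this

/-! ### Averages over maps and over injective maps -/

/-- The probability that a uniformly random map from a `k`-set to an `n`-set is not injective. -/
def collisionProb (k n : ℕ) : ℝ := 1 - (n.descFactorial k : ℝ) / (n : ℝ) ^ k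

lemma tendsto_collisionProb (k : ℕ) : Tendsto (collisionProb k) atTop (𝓝 0) := by
  have h := (Asymptotics.isEquivalent_iff_tendsto_one (by
    filter_upwards [eventually_gt_atTop 0] with n hn
    positivity)).1 (isEquivalent_descFactorial k)
  have := (tendsto_const_nhds (x := (1 : ℝ))).sub h
  rw [sub_self] at this
  exact this

/-- The average of a function over all maps `ι → Fin n`. -/
def mapAverage {ι : Type*} [Fintype ι] [DecidableEq ι] {n : ℕ} (f : (ι → Fin n) → ℝ) : ℝ :=
  (∑ φ, f φ) / (n : ℝ) ^ Fintype.card ι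

lemma mapAverage_const {ι : Type*} [Fintype ι] [DecidableEq ι] {n : ℕ} (hn : 0 < n) (c : ℝ) :
    mapAverage (fun _ : ι → Fin n => c) = c := by
  have : (n : ℝ) ≠ 0 := by positivity
  simp [mapAverage]
  field_simp

/-- Only the non-injective maps contribute, each at most 1, and `collisionProb` is their proportion.
-/
lemma abs_mapAverage_sub_le {ι : Type*} [Fintype ι] [DecidableEq ι] {n : ℕ} (hn : 0 < n)
    {f g : (ι → Fin n) → ℝ} (h1 : ∀ φ, |f φ - g φ| ≤ 1)
    (h0 : ∀ φ, Function.Injective φ → f φ = g φ) :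
    |mapAverage f - mapAverage g| ≤ collisionProb (Fintype.card ι) n := by
  classical
  have hpos : (0 : ℝ) < (n : ℝ) ^ Fintype.card ι := by positivity
  have hcard : (Finset.univ.filter fun φ : ι → Fin n => Function.Injective φ).card =
      n.descFactorial (Fintype.card ι) := by
    rw [← Fintype.card_subtype, Fintype.card_congr (Equiv.subtypeInjectiveEquivEmbedding ι (Fin n)),
      Fintype.card_embedding_eq, Fintype.card_fin]
  have hnot : ((Finset.univ.filter fun φ : ι → Fin n => ¬ Function.Injective φ).card : ℝ) =
      (n : ℝ) ^ Fintype.card ι - n.descFactorial (Fintype.card ι) := by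
    have := Finset.card_filter_add_card_filter_not (s := (Finset.univ : Finset (ι → Fin n)))
      (fun φ : ι → Fin n => Function.Injective φ)
    rw [hcard, Finset.card_univ, Fintype.card_fun, Fintype.card_fin] at this
    rw [eq_sub_iff_add_eq']
    exact_mod_cast this
  have hsum : |∑ φ, f φ - ∑ φ, g φ| ≤
      (n : ℝ) ^ Fintype.card ι - n.descFactorial (Fintype.card ι) := by
    rw [← hnot, ← Finset.sum_sub_distrib, Finset.card_filter, Nat.cast_sum]
    refine (Finset.abs_sum_le_sum_abs _ _).trans (Finset.sum_le_sum fun φ _ => ?_)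
    split_ifs with h
    · simp [h0 φ h]
    · simpa using h1 φ
  rw [mapAverage, mapAverage, ← sub_div, abs_div, abs_of_pos hpos, collisionProb,
    div_le_iff₀ hpos, sub_mul, div_mul_cancel₀ _ hpos.ne', one_mul]
  exact hsum

/-! ### Homomorphism densities of interval graphs -/

/-- The density of `F` in the empirical measure of the intervals `x`. -/
def sampleDensity (F : FinGraph) {n : ℕ} (x : Fin n → IntervalSpace) : ℝ :=
  mapAverage fun φ : Fin F.order → Fin n => (meetSet F).indicator 1 (x ∘ φ)

lemma abs_sub_le_one_of_mem_Icc {a b : ℝ} (ha : a ∈ Set.Icc (0 : ℝ) 1)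
    (hb : b ∈ Set.Icc (0 : ℝ) 1) : |a - b| ≤ 1 := by
  rw [abs_le]
  constructor <;> linarith [ha.1, ha.2, hb.1, hb.2]

lemma indicator_one_mem_Icc {α : Type*} (s : Set α) (x : α) :
    s.indicator (1 : α → ℝ) x ∈ Set.Icc (0 : ℝ) 1 := by
  classical
  rw [Set.indicator_apply]
  split_ifs <;> simp

/-- `x` represents `G` by intervals in `[0, 1]`. -/
def Represents (G : FinGraph) (x : Fin G.order → IntervalSpace) : Prop :=
  ∀ v w, v ≠ w → (G.graph.Adj v w ↔ Meet (x v) (x w))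

/-- An interval meets itself while a vertex is not adjacent to itself, so the two counts differ only
at maps that collapse an edge of `F`, and these are not injective. -/
lemma abs_homDensity_sub_sampleDensity_le (F G : FinGraph) (hG : 0 < G.order)
    {x : Fin G.order → IntervalSpace} (hx : Represents G x) :
    |homDensity F G - sampleDensity F x| ≤ collisionProb F.order G.order := by
  classical
  have hhom : homDensity F G = mapAverage (Set.indicator
      {φ : Fin F.order → Fin G.order | ∀ i j, F.graph.Adj i j → G.graph.Adj (φ i) (φ j)}
      (1 : (Fin F.order → Fin G.order) → ℝ)) := by
    have e : (F.graph →g G.graph) ≃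
        {φ : Fin F.order → Fin G.order // ∀ i j, F.graph.Adj i j → G.graph.Adj (φ i) (φ j)} :=
      { toFun := fun h => ⟨h, fun _ _ hij => h.map_rel hij⟩
        invFun := fun h => ⟨h.1, fun hij => h.2 _ _ hij⟩
        left_inv := fun _ => rfl
        right_inv := fun _ => rfl }
    rw [homDensity, mapAverage, Fintype.card_fin, Nat.card_congr e, Nat.card_eq_fintype_card,
      Fintype.card_subtype, Finset.card_filter]
    push_cast
    simp [Set.indicator_apply]
  rw [hhom, sampleDensity]
  refine (abs_mapAverage_sub_le hG (fun φ => abs_sub_le_one_of_mem_Icc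
    (indicator_one_mem_Icc _ _) (indicator_one_mem_Icc _ _)) fun φ hφ => ?_).trans_eq
    (by rw [Fintype.card_fin])
  simp only [Set.indicator_apply, mem_meetSet_iff, Set.mem_ofPred_eq, Pi.one_apply,
    Function.comp_apply]
  congr 1
  refine propext (forall₃_congr fun i j hij => ?_)
  exact hx _ _ (hφ.ne hij.ne)

lemma tendsto_homDensity_iff (F : FinGraph) {G : ℕ → FinGraph}
    (hG : Tendsto (fun n => (G n).order) atTop atTop)
    {x : ∀ n, Fin (G n).order → IntervalSpace} (hx : ∀ n, Represents (G n) (x n)) {t : ℝ} :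
    Tendsto (fun n => homDensity F (G n)) atTop (𝓝 t) ↔
      Tendsto (fun n => sampleDensity F (x n)) atTop (𝓝 t) := by
  have h : Tendsto (fun n => homDensity F (G n) - sampleDensity F (x n)) atTop (𝓝 0) := by
    refine squeeze_zero_norm' ?_ ((tendsto_collisionProb F.order).comp hG)
    filter_upwards [hG.eventually_gt_atTop 0] with n hn
    exact abs_homDensity_sub_sampleDensity_le F (G n) hn (hx n)
  constructor
  · intro h1
    simpa using h1.sub h
  · intro h1
    simpa using h1.add h

/-! ### Sampling -/

/-- The interval graph of a finite family of intervals. -/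
def intersectionGraph {n : ℕ} (x : Fin n → IntervalSpace) : FinGraph where
  order := n
  graph :=
    { Adj := fun v w => v ≠ w ∧ Meet (x v) (x w)
      symm := ⟨fun _ _ h => ⟨h.1.symm, h.2.symm⟩⟩
      loopless := ⟨fun _ h => h.1 rfl⟩ }

lemma represents_intersectionGraph {n : ℕ} (x : Fin n → IntervalSpace) :
    Represents (intersectionGraph x) x :=
  fun _ _ h => and_iff_right h

lemma isIntervalGraph_intersectionGraph {n : ℕ} (x : Fin n → IntervalSpace) :
    IsIntervalGraph (intersectionGraph x) := by
  refine ⟨fun v => Set.Icc (leftEnd (x v) : ℝ) (rightEnd (x v)),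
    fun v => ⟨Set.ordConnected_Icc, Set.nonempty_Icc.2 (leftEnd_le_rightEnd (x v))⟩,
    fun v w hvw => ?_⟩
  rw [represents_intersectionGraph x v w hvw]
  have hv : (leftEnd (x v) : ℝ) ≤ rightEnd (x v) := leftEnd_le_rightEnd (x v)
  have hw : (leftEnd (x w) : ℝ) ≤ rightEnd (x w) := leftEnd_le_rightEnd (x w)
  simp only [Set.Icc_inter_Icc, Set.nonempty_Icc, Meet, sup_le_iff, le_inf_iff,
    ← Subtype.coe_le_coe]
  tauto

/-- By linearity the expectation is an average over `φ`, and for injective `φ` the points `x ∘ φ`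
are i.i.d., so the term equals the limit exactly. -/
lemma tendsto_integral_mapAverage {ι S : Type*} [Fintype ι] [DecidableEq ι] [MeasurableSpace S]
    (μ : Measure S) [IsProbabilityMeasure μ] {g : (ι → S) → ℝ} (hg : Measurable g)
    (hg1 : ∀ y, g y ∈ Set.Icc (0 : ℝ) 1) :
    Tendsto (fun n : ℕ => ∫ x : Fin n → S, mapAverage (fun φ : ι → Fin n => g (x ∘ φ))
      ∂(Measure.pi fun _ => μ)) atTop (𝓝 (∫ y, g y ∂(Measure.pi fun _ => μ))) := by
  have hint : ∀ (ν : Measure (ι → S)) [IsProbabilityMeasure ν], Integrable g ν := fun ν _ =>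
    Integrable.of_mem_Icc 0 1 hg.aemeasurable (ae_of_all _ hg1)
  have hmem : ∀ (ν : Measure (ι → S)) [IsProbabilityMeasure ν],
      ∫ y, g y ∂ν ∈ Set.Icc (0 : ℝ) 1 := fun ν _ =>
    ⟨integral_nonneg fun y => (hg1 y).1, by
      simpa using integral_mono (hint ν) (integrable_const 1) fun y => (hg1 y).2⟩
  have hm : ∀ {n : ℕ} (φ : ι → Fin n), Measurable fun x : Fin n → S => x ∘ φ := fun φ =>
    measurable_pi_lambda _ fun i => measurable_pi_apply (φ i)
  rw [tendsto_iff_norm_sub_tendsto_zero]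
  refine squeeze_zero' (Eventually.of_forall fun n => norm_nonneg _) ?_
    (tendsto_collisionProb (Fintype.card ι))
  filter_upwards [eventually_gt_atTop 0] with n hn
  have h1 : ∫ x : Fin n → S, mapAverage (fun φ : ι → Fin n => g (x ∘ φ))
      ∂(Measure.pi fun _ => μ) =
      mapAverage fun φ : ι → Fin n => ∫ x : Fin n → S, g (x ∘ φ) ∂(Measure.pi fun _ => μ) := by
    simp only [mapAverage]
    rw [integral_div, integral_finsetSum]
    intro φ _
    exact Integrable.of_mem_Icc 0 1 (hg.comp (hm φ)).aemeasurable (ae_of_all _ fun x => hg1 _)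
  -- The limit is written as an average of constants, so that the two sides can be compared map by
  -- map.
  rw [h1, ← mapAverage_const (ι := ι) hn (∫ y, g y ∂(Measure.pi fun _ => μ))]
  refine abs_mapAverage_sub_le hn (fun φ => abs_sub_le_one_of_mem_Icc ?_ (hmem _)) fun φ hφ => ?_
  · have : IsProbabilityMeasure
        ((Measure.pi fun _ : Fin n => μ).map fun x : Fin n → S => x ∘ φ) :=
      Measure.isProbabilityMeasure_map (hm φ).aemeasurable
    have h2 := hmem ((Measure.pi fun _ : Fin n => μ).map fun x : Fin n → S => x ∘ φ)
    rwa [integral_map (hm φ).aemeasurable hg.aestronglyMeasurable] at h2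
  · have hp := measurePreserving_comp_injective μ hφ
    rw [← hp.map_eq, integral_map (hm φ).aemeasurable hg.aestronglyMeasurable]

lemma measurable_indicator_meetSet (F : FinGraph) :
    Measurable ((meetSet F).indicator (1 : (Fin F.order → IntervalSpace) → ℝ)) :=
  measurable_one.indicator (isClosed_meetSet F).measurableSet

lemma measurable_sampleDensity (F : FinGraph) (n : ℕ) :
    Measurable (sampleDensity F : (Fin n → IntervalSpace) → ℝ) := by
  refine Measurable.div_const (Finset.measurable_sum _ fun φ _ => ?_) _
  exact (measurable_indicator_meetSet F).comp
    (measurable_pi_lambda _ fun i => measurable_pi_apply (φ i))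

lemma sampleDensity_mem_Icc (F : FinGraph) {n : ℕ} (x : Fin n → IntervalSpace) :
    sampleDensity F x ∈ Set.Icc (0 : ℝ) 1 := by
  refine ⟨div_nonneg (Finset.sum_nonneg fun φ _ => (indicator_one_mem_Icc _ _).1) (by positivity),
    div_le_one_of_le₀ ?_ (by positivity)⟩
  refine (Finset.sum_le_sum fun φ _ => (indicator_one_mem_Icc _ _).2).trans ?_
  simp

lemma tendsto_integral_sampleDensity (μ : ProbabilityMeasure IntervalSpace) (F : FinGraph) :
    Tendsto (fun n : ℕ => ∫ x : Fin n → IntervalSpace, sampleDensity F x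
      ∂(Measure.pi fun _ => (μ : Measure IntervalSpace))) atTop (𝓝 (limitOf μ F)) := by
  have h := tendsto_integral_mapAverage (μ : Measure IntervalSpace)
    (measurable_indicator_meetSet F) (indicator_one_mem_Icc _)
  rwa [integral_indicator_one (isClosed_meetSet F).measurableSet, ← limitOf_apply] at h

/-- The square of an average over maps from `F` is an average over maps from two disjoint copies of
`F`, so the second moment is a first moment for the index type `Fin F.order ⊕ Fin F.order`. -/
lemma tendsto_integral_sampleDensity_sq (μ : ProbabilityMeasure IntervalSpace) (F : FinGraph) :
    Tendsto (fun n : ℕ => ∫ x : Fin n → IntervalSpace, sampleDensity F x ^ 2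
      ∂(Measure.pi fun _ => (μ : Measure IntervalSpace))) atTop (𝓝 (limitOf μ F ^ 2)) := by
  let f := (meetSet F).indicator (1 : (Fin F.order → IntervalSpace) → ℝ)
  let g : (Fin F.order ⊕ Fin F.order → IntervalSpace) → ℝ :=
    fun y => f (y ∘ Sum.inl) * f (y ∘ Sum.inr)
  have hf : Measurable f := measurable_indicator_meetSet F
  have hg : Measurable g :=
    (hf.comp (measurable_pi_lambda _ fun i => measurable_pi_apply (Sum.inl i))).mul
      (hf.comp (measurable_pi_lambda _ fun i => measurable_pi_apply (Sum.inr i)))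
  have hg1 : ∀ y, g y ∈ Set.Icc (0 : ℝ) 1 := fun y =>
    unitInterval.mul_mem (indicator_one_mem_Icc _ _) (indicator_one_mem_Icc _ _)
  have h := tendsto_integral_mapAverage (μ : Measure IntervalSpace) hg hg1
  have hlim : ∫ y, g y ∂(Measure.pi fun _ => (μ : Measure IntervalSpace)) = limitOf μ F ^ 2 := by
    have hp := measurePreserving_sumPiEquivProdPi
      (fun _ : Fin F.order ⊕ Fin F.order => (μ : Measure IntervalSpace))
    have h1 := hp.integral_comp' (fun p : (Fin F.order → IntervalSpace) ×
      (Fin F.order → IntervalSpace) => f p.1 * f p.2)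
    rw [integral_prod_mul, integral_indicator_one (isClosed_meetSet F).measurableSet,
      ← limitOf_apply, ← pow_two] at h1
    exact h1
  rw [hlim] at h
  refine h.congr fun n => integral_congr_ae (ae_of_all _ fun x => ?_)
  simp only [sampleDensity, mapAverage, Fintype.card_sum, Fintype.card_fin, g, f]
  rw [div_pow, ← pow_mul, mul_two, pow_two, Finset.sum_mul_sum, ← Finset.sum_product',
    Finset.univ_product_univ, ← (Equiv.sumArrowEquivProdArrow _ _ _).sum_comp]
  rfl

lemma tendsto_integral_sampleDensity_sub_sq (μ : ProbabilityMeasure IntervalSpace)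
    (F : FinGraph) :
    Tendsto (fun n : ℕ => ∫ x : Fin n → IntervalSpace, (sampleDensity F x - limitOf μ F) ^ 2
      ∂(Measure.pi fun _ => (μ : Measure IntervalSpace))) atTop (𝓝 0) := by
  have h := ((tendsto_integral_sampleDensity_sq μ F).sub
    ((tendsto_integral_sampleDensity μ F).const_mul (2 * limitOf μ F))).add_const (limitOf μ F ^ 2)
  have h0 : limitOf μ F ^ 2 - 2 * limitOf μ F * limitOf μ F + limitOf μ F ^ 2 = 0 := by ring
  rw [h0] at h
  refine h.congr fun n => ?_
  have i1 : Integrable (fun x : Fin n → IntervalSpace => sampleDensity F x)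
      (Measure.pi fun _ => (μ : Measure IntervalSpace)) :=
    Integrable.of_mem_Icc 0 1 (measurable_sampleDensity F n).aemeasurable
      (ae_of_all _ fun x => sampleDensity_mem_Icc F x)
  have i2 : Integrable (fun x : Fin n → IntervalSpace => sampleDensity F x ^ 2)
      (Measure.pi fun _ => (μ : Measure IntervalSpace)) :=
    Integrable.of_mem_Icc 0 1 ((measurable_sampleDensity F n).pow_const 2).aemeasurable
      (ae_of_all _ fun x => by
        simpa only [pow_two] using
          unitInterval.mul_mem (sampleDensity_mem_Icc F x) (sampleDensity_mem_Icc F x))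
  have i3 : Integrable (fun x : Fin n → IntervalSpace =>
      sampleDensity F x ^ 2 - 2 * limitOf μ F * sampleDensity F x)
      (Measure.pi fun _ => (μ : Measure IntervalSpace)) := i2.sub (i1.const_mul _)
  rw [← integral_const_mul, ← integral_sub i2 (i1.const_mul _)]
  have : ∀ c : ℝ, ∫ _ : Fin n → IntervalSpace, c
      ∂(Measure.pi fun _ => (μ : Measure IntervalSpace)) = c := by simp
  conv_lhs => rw [← this (limitOf μ F ^ 2)]
  rw [← integral_add i3 (integrable_const _)]
  refine integral_congr_ae (ae_of_all _ fun x => ?_)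
  simp only
  ring

instance : Countable FinGraph := by
  have : Function.Injective fun F : FinGraph =>
      (⟨F.order, F.graph⟩ : Σ n : ℕ, SimpleGraph (Fin n)) := by
    rintro ⟨n, G⟩ ⟨m, H⟩ h
    simp only [Sigma.mk.injEq] at h
    obtain ⟨rfl, h⟩ := h
    rw [eq_of_heq h]
  exact this.countable

instance : Nonempty FinGraph := ⟨⟨0, ⊥⟩⟩

/-- The expected sum of squared errors over `s` tends to 0, and some sample does no worse than the
mean. Almost sure convergence is not needed. -/
lemma exists_sample (μ : ProbabilityMeasure IntervalSpace) (s : Finset FinGraph) (m : ℕ)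
    {ε : ℝ} (hε : 0 < ε) :
    ∃ n, m ≤ n ∧ ∃ x : Fin n → IntervalSpace, ∀ F ∈ s,
      (sampleDensity F x - limitOf μ F) ^ 2 ≤ ε := by
  have h : Tendsto (fun n : ℕ => ∑ F ∈ s, ∫ x : Fin n → IntervalSpace,
      (sampleDensity F x - limitOf μ F) ^ 2
      ∂(Measure.pi fun _ => (μ : Measure IntervalSpace))) atTop (𝓝 0) := by
    simpa using tendsto_finsetSum s fun F _ => tendsto_integral_sampleDensity_sub_sq μ F
  obtain ⟨n, hn, hmn⟩ := ((h.eventually_le_const hε).and (eventually_ge_atTop m)).exists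
  have hint : ∀ F : FinGraph, Integrable
      (fun x : Fin n → IntervalSpace => (sampleDensity F x - limitOf μ F) ^ 2)
      (Measure.pi fun _ => (μ : Measure IntervalSpace)) := fun F => by
    have hl : limitOf μ F ∈ Set.Icc (0 : ℝ) 1 := by
      rw [limitOf_apply]
      exact ⟨measureReal_nonneg, measureReal_le_one⟩
    refine Integrable.of_mem_Icc 0 1
      (((measurable_sampleDensity F n).sub_const _).pow_const 2).aemeasurable
      (ae_of_all _ fun x => ⟨sq_nonneg _, ?_⟩)
    rw [sq_le_one_iff_abs_le_one]
    exact abs_sub_le_one_of_mem_Icc (sampleDensity_mem_Icc F x) hl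
  rw [← integral_finsetSum s fun F _ => hint F] at hn
  obtain ⟨x, hx⟩ := exists_le_integral (integrable_finsetSum s fun F _ => hint F)
  refine ⟨n, hmn, x, fun F hF => ?_⟩
  exact (Finset.single_le_sum (f := fun F => (sampleDensity F x - limitOf μ F) ^ 2)
    (fun _ _ => sq_nonneg _) hF).trans (hx.trans hn)

theorem limitOf_mem_intervalGraphLimits (μ : ProbabilityMeasure IntervalSpace) :
    limitOf μ ∈ intervalGraphLimits := by
  classical
  obtain ⟨e, he⟩ := exists_surjective_nat FinGraph
  -- Diagonal choice: sample `m` controls the first `m` graphs of the enumeration up to squared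
  -- error `1 / (m + 1)`.
  choose n hn x hx using fun m : ℕ =>
    exists_sample μ ((Finset.range m).image e) m (ε := 1 / ((m : ℝ) + 1)) (by positivity)
  have horder : Tendsto (fun m => (intersectionGraph (x m)).order) atTop atTop :=
    tendsto_atTop_mono hn tendsto_id
  have hconv : ConvergesTo (fun m => intersectionGraph (x m)) (limitOf μ) := by
    refine ⟨horder, fun F => ?_⟩
    refine (tendsto_homDensity_iff F horder fun m => represents_intersectionGraph (x m)).2 ?_
    obtain ⟨j, rfl⟩ := he F
    have hsq : Tendsto (fun m => (sampleDensity (e j) (x m) - limitOf μ (e j)) ^ 2)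
        atTop (𝓝 0) := by
      refine squeeze_zero' (Eventually.of_forall fun m => sq_nonneg _) ?_
        tendsto_one_div_add_atTop_nhds_zero_nat
      filter_upwards [eventually_gt_atTop j] with m hm
      exact hx m _ (Finset.mem_image_of_mem e (Finset.mem_range.2 hm))
    rw [tendsto_iff_norm_sub_tendsto_zero]
    have hsqrt := hsq.sqrt
    simp only [Real.sqrt_sq_eq_abs, Real.sqrt_zero] at hsqrt
    exact hsqrt
  exact ⟨⟨_, hconv⟩, _, fun m => isIntervalGraph_intersectionGraph (x m), hconv⟩

/-! ### Midpoint sums -/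

/-- The point `c / (2m)` of the unit interval. -/
def gridPoint (m c : ℕ) : unitInterval := Set.projIcc 0 1 zero_le_one ((c : ℝ) / (2 * m))

lemma monotone_gridPoint (m : ℕ) : Monotone (gridPoint m) := fun c d hcd => by
  refine Set.monotone_projIcc _ ?_
  gcongr

lemma gridPoint_lt_gridPoint {m c d : ℕ} (hcd : c < d) (hd : d ≤ 2 * m) :
    gridPoint m c < gridPoint m d := by
  have hm : (0 : ℝ) < 2 * m := by exact_mod_cast (by omega : 0 < 2 * m)
  have hd' : (d : ℝ) / (2 * m) ≤ 1 := (div_le_one hm).2 (by exact_mod_cast hd)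
  have hlt : (c : ℝ) / (2 * m) < d / (2 * m) := by gcongr
  exact Set.strictMonoOn_projIcc zero_le_one ⟨by positivity, hlt.le.trans hd'⟩
    ⟨by positivity, hd'⟩ hlt

/-- The midpoint Riemann sum of `f` with `m` cells. -/
def midpointSum (m : ℕ) (f : unitInterval → ℝ) : ℝ :=
  (∑ r ∈ Finset.range m, f (gridPoint m (2 * r + 1))) / m

lemma tendsto_midpointSum {f : unitInterval → ℝ} (hf : Continuous f) :
    Tendsto (fun m => midpointSum m f) atTop (𝓝 (∫ t, f t)) := by
  let g : ℝ → ℝ := Set.IccExtend zero_le_one f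
  have hg : Continuous g := hf.Icc_extend'
  have hint : ∫ t, f t = ∫ s in (0 : ℝ)..1, g s := by
    rw [intervalIntegral.integral_of_le zero_le_one, ← integral_Icc_eq_integral_Ioc,
      ← unitInterval.measurePreserving_coe.integral_comp unitInterval.measurableEmbedding_coe]
    refine integral_congr_ae (ae_of_all _ fun t => ?_)
    exact (Set.IccExtend_val zero_le_one f t).symm
  have hu : UniformContinuousOn g (Set.Icc 0 1) :=
    isCompact_Icc.uniformContinuousOn_of_continuous hg.continuousOn
  rw [hint, Metric.tendsto_atTop]
  intro ε hε
  obtain ⟨δ, hδ, hδ'⟩ := Metric.uniformContinuousOn_iff_le.1 hu (ε / 2) (by positivity)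
  obtain ⟨M, hM⟩ := exists_nat_one_div_lt hδ
  refine ⟨M + 1, fun m hm => ?_⟩
  have hm0 : (0 : ℝ) < m := by exact_mod_cast (by omega : 0 < m)
  have hmδ : 1 / (m : ℝ) ≤ δ := by
    refine le_trans ?_ hM.le
    exact one_div_le_one_div_of_le (by positivity) (by exact_mod_cast hm)
  have hsplit : ∫ s in (0 : ℝ)..1, g s =
      ∑ r ∈ Finset.range m, ∫ s in ((r : ℕ) / m : ℝ)..((r + 1 : ℕ) / m : ℝ), g s := by
    rw [intervalIntegral.sum_integral_adjacent_intervals (a := fun r : ℕ => (r / m : ℝ))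
      fun r _ => hg.intervalIntegrable _ _]
    simp [hm0.ne']
  have hcell : ∀ r ∈ Finset.range m,
      |f (gridPoint m (2 * r + 1)) / m -
        ∫ s in ((r : ℕ) / m : ℝ)..((r + 1 : ℕ) / m : ℝ), g s| ≤ ε / 2 * (1 / m) := by
    intro r hr
    have hr1 : ((r + 1 : ℕ) : ℝ) ≤ m := by exact_mod_cast Finset.mem_range.1 hr
    have hlen : ((r + 1 : ℕ) / m : ℝ) - r / m = 1 / m := by
      push_cast
      ring
    have hle : (r / m : ℝ) ≤ (r + 1 : ℕ) / m := by
      have : (0 : ℝ) < 1 / m := by positivity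
      linarith
    have hlow : (0 : ℝ) ≤ r / m := by positivity
    have hhigh : ((r + 1 : ℕ) / m : ℝ) ≤ 1 := (div_le_one hm0).2 hr1
    -- The midpoint of the cell from `r / m` to `(r + 1) / m`.
    let p : ℝ := ((2 * r + 1 : ℕ) : ℝ) / (2 * m)
    have hp1 : (r / m : ℝ) ≤ p := by
      simp only [p]
      rw [div_le_div_iff₀ hm0 (by positivity)]
      push_cast
      nlinarith
    have hp2 : p ≤ (r + 1 : ℕ) / m := by
      simp only [p]
      rw [div_le_div_iff₀ (by positivity) hm0]
      push_cast
      nlinarith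
    have hconst : f (gridPoint m (2 * r + 1)) / m =
        ∫ _ in (r / m : ℝ)..((r + 1 : ℕ) / m : ℝ), g p := by
      rw [intervalIntegral.integral_const, hlen, smul_eq_mul, one_div_mul_eq_div]
      rfl
    rw [hconst, ← intervalIntegral.integral_sub (by simp) (hg.intervalIntegrable _ _)]
    have hb := intervalIntegral.norm_integral_le_of_norm_le_const (a := (r / m : ℝ))
      (b := ((r + 1 : ℕ) / m : ℝ)) (f := fun s => g p - g s) (C := ε / 2) fun s hs => by
        rw [Set.uIoc_of_le hle] at hs
        refine hδ' p ⟨hlow.trans hp1, hp2.trans hhigh⟩ s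
          ⟨hlow.trans hs.1.le, hs.2.trans hhigh⟩ (le_trans ?_ hmδ)
        rw [Real.dist_eq, abs_le]
        constructor <;> linarith [hs.1, hs.2]
    rwa [hlen, abs_of_nonneg (by positivity : (0 : ℝ) ≤ 1 / m)] at hb
  rw [Real.dist_eq, midpointSum, Finset.sum_div, hsplit, ← Finset.sum_sub_distrib]
  calc _ ≤ ∑ r ∈ Finset.range m, ε / 2 * (1 / m) :=
        (Finset.abs_sum_le_sum_abs _ _).trans (Finset.sum_le_sum hcell)
    _ = ε / 2 := by
        rw [Finset.sum_const, Finset.card_range, nsmul_eq_mul]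
        field_simp
    _ < ε := by linarith

/-! ### Ranks -/

section Rank

variable {K E : Type*} [LinearOrder K] [Fintype E]

/-- Twice the position of `t` among the values of `e`, with ties counted halfway. -/
def doubleRank (e : E → K) (t : K) : ℕ :=
  (Finset.univ.filter fun i => e i ≤ t).card + (Finset.univ.filter fun i => e i < t).card

lemma monotone_doubleRank (e : E → K) : Monotone (doubleRank e) := fun _ _ hst =>
  add_le_add (Finset.card_le_card fun _ hi => by
      simp only [Finset.mem_filter_univ] at hi ⊢
      exact hi.trans hst)
    (Finset.card_le_card fun _ hi => by
      simp only [Finset.mem_filter_univ] at hi ⊢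
      exact hi.trans_le hst)

/-- If `s` is a value of `e`, the strict count increases; if `t` is one, the weak count does. Using
both counts makes either hypothesis sufficient. -/
lemma doubleRank_lt_doubleRank (e : E → K) {s t : K} (hst : s < t)
    (h : s ∈ Set.range e ∨ t ∈ Set.range e) : doubleRank e s < doubleRank e t := by
  rcases h with ⟨i, rfl⟩ | ⟨i, rfl⟩
  · refine add_lt_add_of_le_of_lt (Finset.card_le_card fun j hj => ?_)
      (Finset.card_lt_card (Finset.ssubset_iff_of_subset (fun j hj => ?_) |>.2 ⟨i, ?_, ?_⟩))
    · simp only [Finset.mem_filter_univ] at hj ⊢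
      exact hj.trans hst.le
    · simp only [Finset.mem_filter_univ] at hj ⊢
      exact hj.trans hst
    · simpa using hst
    · simp
  · refine add_lt_add_of_lt_of_le
      (Finset.card_lt_card (Finset.ssubset_iff_of_subset (fun j hj => ?_) |>.2 ⟨i, ?_, ?_⟩))
      (Finset.card_le_card fun j hj => ?_)
    · simp only [Finset.mem_filter_univ] at hj ⊢
      exact hj.trans hst.le
    · simp
    · simpa using hst
    · simp only [Finset.mem_filter_univ] at hj ⊢
      exact hj.trans hst

lemma doubleRank_le (e : E → K) (t : K) : doubleRank e t ≤ 2 * Fintype.card E := by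
  rw [two_mul]
  exact add_le_add (Finset.card_le_univ _) (Finset.card_le_univ _)

/-- Without ties, a value with `r` values below it has double rank `2 * r + 1`, and each `r` occurs
once. -/
lemma sum_doubleRank {e : E → K} (he : Function.Injective e) (h : ℕ → ℝ) :
    ∑ i, h (doubleRank e (e i)) = ∑ r ∈ Finset.range (Fintype.card E), h (2 * r + 1) := by
  classical
  have hrank : ∀ i, doubleRank e (e i) =
      2 * (Finset.univ.filter fun j => e j < e i).card + 1 := by
    intro i
    have : (Finset.univ.filter fun j => e j ≤ e i) =
        insert i (Finset.univ.filter fun j => e j < e i) := by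
      ext j
      simp only [Finset.mem_filter_univ, Finset.mem_insert, le_iff_lt_or_eq, he.eq_iff]
      tauto
    rw [doubleRank, this, Finset.card_insert_of_notMem (by simp)]
    omega
  let ρ : E → Fin (Fintype.card E) := fun i =>
    ⟨(Finset.univ.filter fun j => e j < e i).card, by
      rw [← Finset.card_univ]
      exact Finset.card_lt_card (Finset.ssubset_univ_iff.2 fun hu => by
        simpa using Finset.ext_iff.1 hu i)⟩
  have hρ : Function.Injective ρ := by
    intro i j hij
    by_contra hne
    have hij' : doubleRank e (e i) = doubleRank e (e j) := by
      rw [hrank, hrank, Fin.mk.inj_iff.1 hij]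
    rcases lt_or_gt_of_ne (he.ne hne) with hlt | hlt
    · exact (doubleRank_lt_doubleRank e hlt (Or.inl ⟨i, rfl⟩)).ne hij'
    · exact (doubleRank_lt_doubleRank e hlt (Or.inl ⟨j, rfl⟩)).ne' hij'
  have hbij : Function.Bijective ρ :=
    (Fintype.bijective_iff_injective_and_card ρ).2 ⟨hρ, (Fintype.card_fin _).symm⟩
  rw [Finset.sum_range fun r => h (2 * r + 1), ← hbij.sum_comp fun r => h (2 * (r : ℕ) + 1)]
  exact Finset.sum_congr rfl fun i _ => by rw [hrank]

/-- The position of `t` among the values of `e`, rescaled to the unit interval. -/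
def rankPoint (e : E → K) (t : K) : unitInterval := gridPoint (Fintype.card E) (doubleRank e t)

lemma monotone_rankPoint (e : E → K) : Monotone (rankPoint e) :=
  (monotone_gridPoint _).comp (monotone_doubleRank e)

lemma rankPoint_le_rankPoint_iff (e : E → K) {s t : K}
    (h : s ∈ Set.range e ∨ t ∈ Set.range e) : rankPoint e s ≤ rankPoint e t ↔ s ≤ t := by
  refine ⟨fun hst => ?_, fun hst => monotone_rankPoint e hst⟩
  by_contra! hlt
  exact hst.not_gt
    (gridPoint_lt_gridPoint (doubleRank_lt_doubleRank e hlt h.symm) (doubleRank_le e s))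

lemma sum_rankPoint {e : E → K} (he : Function.Injective e) (f : unitInterval → ℝ) :
    (∑ i, f (rankPoint e (e i))) / Fintype.card E = midpointSum (Fintype.card E) f := by
  rw [midpointSum, ← sum_doubleRank he fun c => f (gridPoint (Fintype.card E) c)]
  rfl

end Rank

/-! ### Normal forms of interval graphs -/

/-- Finitely many witness points decide all adjacencies, so each interval can be shrunk to the
closed hull of the witnesses it contains. -/
lemma IsIntervalGraph.exists_endpoints {G : FinGraph} (hG : IsIntervalGraph G) :
    ∃ a b : Fin G.order → ℝ, (∀ v, a v ≤ b v) ∧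
      ∀ v w, v ≠ w → (G.graph.Adj v w ↔ a v ≤ b w ∧ a w ≤ b v) := by
  classical
  obtain ⟨I, hI, hadj⟩ := hG
  have hp : ∀ v w, ∃ p : ℝ, p ∈ I v ∧ ((I v ∩ I w).Nonempty → p ∈ I w) := by
    intro v w
    by_cases h : (I v ∩ I w).Nonempty
    · exact ⟨h.some, h.some_mem.1, fun _ => h.some_mem.2⟩
    · exact ⟨(hI v).2.some, (hI v).2.some_mem, fun h' => absurd h' h⟩
  choose p hp1 hp2 using hp
  -- The witnesses `p v w` and `p w v` may differ; including both kinds puts a common point into `q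
  -- v` and `q w` whenever the intervals meet.
  let q : Fin G.order → Finset ℝ := fun v =>
    (Finset.univ.image fun w => p v w) ∪
      (Finset.univ.filter fun w => (I v ∩ I w).Nonempty).image fun w => p w v
  have hq : ∀ v, (q v).Nonempty := fun v =>
    ⟨p v v, Finset.mem_union_left _ (Finset.mem_image_of_mem _ (Finset.mem_univ v))⟩
  have hqI : ∀ v, ∀ t ∈ q v, t ∈ I v := by
    intro v t ht
    simp only [q, Finset.mem_union, Finset.mem_image, Finset.mem_univ, true_and,
      Finset.mem_filter] at ht
    rcases ht with ⟨w, rfl⟩ | ⟨w, hw, rfl⟩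
    · exact hp1 v w
    · exact hp2 w v (by rwa [Set.inter_comm])
  refine ⟨fun v => (q v).min' (hq v), fun v => (q v).max' (hq v),
    fun v => Finset.min'_le_max' _ _, fun v w hvw => ?_⟩
  rw [hadj v w hvw]
  constructor
  · intro h
    have h1 : p v w ∈ q v :=
      Finset.mem_union_left _ (Finset.mem_image_of_mem _ (Finset.mem_univ w))
    have h2 : p v w ∈ q w := by
      refine Finset.mem_union_right _ (Finset.mem_image_of_mem (fun u => p u w) ?_)
      simpa [Set.inter_comm] using h
    exact ⟨(Finset.min'_le _ _ h1).trans (Finset.le_max' _ _ h2),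
      (Finset.min'_le _ _ h2).trans (Finset.le_max' _ _ h1)⟩
  · rintro ⟨h1, h2⟩
    have mem : ∀ u, Set.Icc ((q u).min' (hq u)) ((q u).max' (hq u)) ⊆ I u := fun u =>
      (hI u).1.out (hqI u _ (Finset.min'_mem _ _)) (hqI u _ (Finset.max'_mem _ _))
    refine Set.Nonempty.mono (Set.inter_subset_inter (mem v) (mem w)) ?_
    rw [Set.Icc_inter_Icc, Set.nonempty_Icc, sup_le_iff, le_inf_iff, le_inf_iff]
    exact ⟨⟨Finset.min'_le_max' _ _, h1⟩, h2, Finset.min'_le_max' _ _⟩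

/-- Ties are broken lexicographically by distinct integer tags. The tags of left endpoints are
smaller than those of right endpoints, so intervals that touch at a point still meet. -/
lemma IsIntervalGraph.exists_distinct_endpoints {G : FinGraph} (hG : IsIntervalGraph G) :
    ∃ a b : Fin G.order → ℝ ×ₗ ℕ, Function.Injective (Sum.elim a b) ∧ (∀ v, a v ≤ b v) ∧
      ∀ v w, v ≠ w → (G.graph.Adj v w ↔ a v ≤ b w ∧ a w ≤ b v) := by
  obtain ⟨a, b, hab, hadj⟩ := hG.exists_endpoints
  have hle : ∀ v w : Fin G.order,
      toLex (a v, (v : ℕ)) ≤ toLex (b w, G.order + w) ↔ a v ≤ b w := by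
    intro v w
    have : (v : ℕ) ≤ G.order + w := by omega
    rw [Prod.Lex.toLex_le_toLex, le_iff_lt_or_eq (a := a v), and_iff_left this]
  refine ⟨fun v => toLex (a v, (v : ℕ)), fun v => toLex (b v, G.order + v), ?_,
    fun v => (hle v v).2 (hab v), fun v w hvw => ?_⟩
  · rintro (v | v) (w | w) h <;>
      simp only [Sum.elim_inl, Sum.elim_inr, EmbeddingLike.apply_eq_iff_eq, Prod.mk.injEq] at h
    · rw [Fin.ext h.2]
    · exact absurd h.2 (by omega)
    · exact absurd h.2 (by omega)
    · rw [Fin.ext (by omega : (v : ℕ) = w)]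
  · rw [hadj v w hvw, hle, hle]

/-- The intervals `[a v, b v]`, with endpoints replaced by their rescaled ranks. -/
def rankInterval {K E V : Type*} [LinearOrder K] [Fintype E] (e : E → K) {a b : V → K}
    (hab : ∀ v, a v ≤ b v) (v : V) : IntervalSpace :=
  ⟨(rankPoint e (a v), rankPoint e (b v)), monotone_rankPoint e (hab v)⟩

/-- Adjacency only ever compares a left endpoint with a right one, so ranks among the endpoints of
one kind already suffice. -/
lemma represents_rankInterval {K E : Type*} [LinearOrder K] [Fintype E] (e : E → K)
    {G : FinGraph} {a b : Fin G.order → K} (hab : ∀ v, a v ≤ b v)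
    (hadj : ∀ v w, v ≠ w → (G.graph.Adj v w ↔ a v ≤ b w ∧ a w ≤ b v))
    (h : Set.range a ⊆ Set.range e ∨ Set.range b ⊆ Set.range e) :
    Represents G (rankInterval e hab) := by
  have hle : ∀ v w, rankPoint e (a v) ≤ rankPoint e (b w) ↔ a v ≤ b w := fun v w =>
    rankPoint_le_rankPoint_iff e (h.imp (fun h => h ⟨v, rfl⟩) fun h => h ⟨w, rfl⟩)
  intro v w hvw
  rw [hadj v w hvw]
  exact and_congr (hle v w).symm (hle w v).symm

lemma IsIntervalGraph.exists_represents_left {G : FinGraph} (hG : IsIntervalGraph G) :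
    ∃ x, Represents G x ∧ ∀ f : unitInterval → ℝ,
      (∑ v, f (leftEnd (x v))) / G.order = midpointSum G.order f := by
  obtain ⟨a, b, hinj, hab, hadj⟩ := hG.exists_distinct_endpoints
  refine ⟨rankInterval a hab, represents_rankInterval a hab hadj (Or.inl subset_rfl), fun f => ?_⟩
  have h := sum_rankPoint (hinj.comp Sum.inl_injective) f
  rw [Fintype.card_fin] at h
  exact h

lemma IsIntervalGraph.exists_represents_right {G : FinGraph} (hG : IsIntervalGraph G) :
    ∃ x, Represents G x ∧ ∀ f : unitInterval → ℝ,
      (∑ v, f (rightEnd (x v))) / G.order = midpointSum G.order f := by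
  obtain ⟨a, b, hinj, hab, hadj⟩ := hG.exists_distinct_endpoints
  refine ⟨rankInterval b hab, represents_rankInterval b hab hadj (Or.inr subset_rfl), fun f => ?_⟩
  have h := sum_rankPoint (hinj.comp Sum.inr_injective) f
  rw [Fintype.card_fin] at h
  exact h

lemma IsIntervalGraph.exists_represents_mean {G : FinGraph} (hG : IsIntervalGraph G) :
    ∃ x, Represents G x ∧ ∀ f : unitInterval → ℝ,
      (∑ v, (f (leftEnd (x v)) + f (rightEnd (x v))) / 2) / G.order =
        midpointSum (2 * G.order) f := by
  obtain ⟨a, b, hinj, hab, hadj⟩ := hG.exists_distinct_endpoints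
  refine ⟨rankInterval (Sum.elim a b) hab, represents_rankInterval _ hab hadj (Or.inl ?_),
    fun f => ?_⟩
  · rintro _ ⟨v, rfl⟩
    exact ⟨Sum.inl v, rfl⟩
  · have h := sum_rankPoint hinj f
    rw [Fintype.sum_sum_type, Fintype.card_sum, Fintype.card_fin, ← two_mul] at h
    rw [← h, ← Finset.sum_div, Finset.sum_add_distrib, div_div]
    push_cast
    rfl

/-! ### Empirical measures -/

lemma pi_uniform_real_singleton {ι α : Type*} [Fintype ι] [Fintype α] [Nonempty α]
    [MeasurableSpace α] [MeasurableSingletonClass α] (φ : ι → α) :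
    (Measure.pi fun _ : ι => (PMF.uniformOfFintype α).toMeasure).real {φ} =
      ((Fintype.card α : ℝ) ^ Fintype.card ι)⁻¹ := by
  simp [measureReal_def, Measure.pi_singleton,
    PMF.toMeasure_apply_singleton _ _ (measurableSet_singleton _)]

/-- The empirical measure of a nonempty finite family of intervals. -/
def empiricalMeasure {n : ℕ} [NeZero n] (x : Fin n → IntervalSpace) :
    ProbabilityMeasure IntervalSpace :=
  ⟨(PMF.uniformOfFintype (Fin n)).toMeasure.map x,
    Measure.isProbabilityMeasure_map (measurable_of_finite x).aemeasurable⟩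

lemma integral_empiricalMeasure {n : ℕ} [NeZero n] (x : Fin n → IntervalSpace)
    {f : IntervalSpace → ℝ} (hf : Continuous f) :
    ∫ s, f s ∂(empiricalMeasure x : Measure IntervalSpace) = (∑ v, f (x v)) / n := by
  simp only [empiricalMeasure, ProbabilityMeasure.coe_mk]
  rw [integral_map (measurable_of_finite x).aemeasurable hf.aestronglyMeasurable,
    integral_fintype Integrable.of_finite]
  simp [measureReal_def, ← Finset.mul_sum, div_eq_inv_mul]

/-- The product power of the empirical measure is the law of `x ∘ φ` for a uniformly random map `φ`.
-/
lemma limitOf_empiricalMeasure {n : ℕ} [NeZero n] (x : Fin n → IntervalSpace) (F : FinGraph) :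
    limitOf (empiricalMeasure x) F = sampleDensity F x := by
  have hx := measurable_of_finite x
  have hpi : (Measure.pi fun _ : Fin F.order =>
      (empiricalMeasure x : Measure IntervalSpace)) =
      (Measure.pi fun _ : Fin F.order => (PMF.uniformOfFintype (Fin n)).toMeasure).map
        fun φ => x ∘ φ :=
    (Measure.pi_map_pi fun _ => hx.aemeasurable).symm
  rw [limitOf_apply, hpi, ← integral_indicator_one (isClosed_meetSet F).measurableSet,
    integral_map (measurable_of_finite _).aemeasurable
      (measurable_indicator_meetSet F).aestronglyMeasurable,
    integral_fintype Integrable.of_finite, sampleDensity, mapAverage, div_eq_inv_mul,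
    Finset.mul_sum]
  simp [pi_uniform_real_singleton]

/-! ### Every interval graph limit is represented -/

/-- If the interval graphs have representations for which the empirical averages of the test
functions `Φ f` are midpoint sums of `f`, every interval graph limit is `Γ_μ` for some `μ` such
that `Φ f` has `μ`-integral `∫ f`. -/
lemma exists_limitOf_eq {Γ : GraphParameter} (hΓ : Γ ∈ intervalGraphLimits) {c : ℕ} (hc : 0 < c)
    (Φ : (unitInterval → ℝ) → IntervalSpace → ℝ)
    (hΦ : ∀ f : unitInterval → ℝ, Continuous f → Continuous (Φ f))
    (hrep : ∀ G : FinGraph, IsIntervalGraph G → ∃ x, Represents G x ∧ ∀ f : unitInterval → ℝ,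
      (∑ v, Φ f (x v)) / G.order = midpointSum (c * G.order) f)
    (hcont : ∀ μ : ProbabilityMeasure IntervalSpace,
      (∀ f : unitInterval → ℝ, Continuous f →
        ∫ s, Φ f s ∂(μ : Measure IntervalSpace) = ∫ t, f t) → ContinuousAt limitOf μ) :
    ∃ μ : ProbabilityMeasure IntervalSpace, limitOf μ = Γ ∧
      ∀ f : unitInterval → ℝ, Continuous f →
        ∫ s, Φ f s ∂(μ : Measure IntervalSpace) = ∫ t, f t := by
  obtain ⟨-, G, hG, horder, hlim⟩ := hΓ
  choose x hx hsum using fun n => hrep (G n) (hG n)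
  have hν : ∀ n, ∃ ν : ProbabilityMeasure IntervalSpace, 0 < (G n).order →
      (∀ F, limitOf ν F = sampleDensity F (x n)) ∧
      ∀ f : unitInterval → ℝ, Continuous f →
        ∫ s, Φ f s ∂(ν : Measure IntervalSpace) = midpointSum (c * (G n).order) f := by
    intro n
    rcases Nat.eq_zero_or_pos (G n).order with h0 | h0
    · exact ⟨⟨Measure.dirac ⟨(0, 0), le_rfl⟩, inferInstance⟩, fun h => absurd h0 h.ne'⟩
    · have : NeZero (G n).order := ⟨h0.ne'⟩
      exact ⟨empiricalMeasure (x n), fun _ => ⟨limitOf_empiricalMeasure (x n), fun f hf => by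
        rw [integral_empiricalMeasure (x n) (hΦ f hf), hsum]⟩⟩
  choose ν hν using hν
  -- An ultrafilter finer than `atTop` takes the place of a convergent subsequence.
  let U : Ultrafilter ℕ := Ultrafilter.of atTop
  have hU : (U : Filter ℕ) ≤ atTop := Ultrafilter.of_le atTop
  obtain ⟨μ, -, hμ⟩ := isCompact_univ.ultrafilter_le_nhds (U.map ν) (by simp)
  have hμ : Tendsto ν U (𝓝 μ) := hμ
  have hpos : ∀ᶠ n in (U : Filter ℕ), 0 < (G n).order := hU (horder.eventually_gt_atTop 0)
  have hμΦ : ∀ f : unitInterval → ℝ, Continuous f →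
      ∫ s, Φ f s ∂(μ : Measure IntervalSpace) = ∫ t, f t := by
    intro f hf
    have h1 := ProbabilityMeasure.tendsto_iff_forall_integral_tendsto.1 hμ
      (BoundedContinuousFunction.mkOfCompact ⟨Φ f, hΦ f hf⟩)
    have h2 : Tendsto (fun n => midpointSum (c * (G n).order) f) U (𝓝 (∫ t, f t)) :=
      ((tendsto_midpointSum hf).comp (horder.const_mul_atTop' hc)).mono_left hU
    refine tendsto_nhds_unique (h1.congr' ?_) h2
    filter_upwards [hpos] with n hn
    exact (hν n hn).2 f hf
  refine ⟨μ, funext fun F => ?_, hμΦ⟩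
  have h1 : Tendsto (fun n => limitOf (ν n) F) U (𝓝 (limitOf μ F)) :=
    (tendsto_pi_nhds.1 (hcont μ hμΦ) F).comp hμ
  have h2 := ((tendsto_homDensity_iff F horder hx).1 (hlim F)).mono_left hU
  refine tendsto_nhds_unique (h1.congr' ?_) h2
  filter_upwards [hpos] with n hn
  exact (hν n hn).1 F

/-! ### The three normalizations -/

lemma continuousAt_limitOf_of_mem_leftUniform {μ : ProbabilityMeasure IntervalSpace}
    (hμ : μ ∈ leftUniform) : ContinuousAt limitOf μ := by
  have hμ : leftMarginal μ = volume := hμ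
  exact continuousAt_limitOf μ (Or.inl fun t => by rw [hμ, measure_singleton])

lemma continuousAt_limitOf_of_mem_rightUniform {μ : ProbabilityMeasure IntervalSpace}
    (hμ : μ ∈ rightUniform) : ContinuousAt limitOf μ := by
  have hμ : rightMarginal μ = volume := hμ
  exact continuousAt_limitOf μ (Or.inr fun t => by rw [hμ, measure_singleton])

/-- An atom of the left marginal would be an atom of the average with half the mass. -/
lemma continuousAt_limitOf_of_mem_meanUniform {μ : ProbabilityMeasure IntervalSpace}
    (hμ : μ ∈ meanUniform) : ContinuousAt limitOf μ := by
  have hμ : (2⁻¹ : ENNReal) • (leftMarginal μ + rightMarginal μ) = volume := hμ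
  refine continuousAt_limitOf μ (Or.inl fun t => ?_)
  have h : ((2⁻¹ : ENNReal) • (leftMarginal μ + rightMarginal μ)) {t} = 0 := by
    rw [hμ, measure_singleton]
  simp only [Measure.smul_apply, Measure.add_apply, smul_eq_mul, mul_eq_zero, add_eq_zero,
    ENNReal.inv_eq_zero, ENNReal.ofNat_ne_top, false_or] at h
  exact h.1

instance (μ : ProbabilityMeasure IntervalSpace) : IsProbabilityMeasure (leftMarginal μ) :=
  Measure.isProbabilityMeasure_map continuous_leftEnd.aemeasurable

instance (μ : ProbabilityMeasure IntervalSpace) : IsProbabilityMeasure (rightMarginal μ) :=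
  Measure.isProbabilityMeasure_map continuous_rightEnd.aemeasurable

lemma integral_leftMarginal (μ : ProbabilityMeasure IntervalSpace) {f : unitInterval → ℝ}
    (hf : Continuous f) :
    ∫ t, f t ∂leftMarginal μ = ∫ s, f (leftEnd s) ∂(μ : Measure IntervalSpace) :=
  integral_map continuous_leftEnd.aemeasurable hf.aestronglyMeasurable

lemma integral_rightMarginal (μ : ProbabilityMeasure IntervalSpace) {f : unitInterval → ℝ}
    (hf : Continuous f) :
    ∫ t, f t ∂rightMarginal μ = ∫ s, f (rightEnd s) ∂(μ : Measure IntervalSpace) :=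
  integral_map continuous_rightEnd.aemeasurable hf.aestronglyMeasurable

lemma mem_leftUniform_of_integral {μ : ProbabilityMeasure IntervalSpace}
    (h : ∀ f : unitInterval → ℝ, Continuous f →
      ∫ s, f (leftEnd s) ∂(μ : Measure IntervalSpace) = ∫ t, f t) : μ ∈ leftUniform :=
  ext_of_forall_integral_eq_of_IsFiniteMeasure fun f => by
    rw [integral_leftMarginal μ f.continuous, h f f.continuous]

lemma mem_rightUniform_of_integral {μ : ProbabilityMeasure IntervalSpace}
    (h : ∀ f : unitInterval → ℝ, Continuous f →
      ∫ s, f (rightEnd s) ∂(μ : Measure IntervalSpace) = ∫ t, f t) : μ ∈ rightUniform :=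
  ext_of_forall_integral_eq_of_IsFiniteMeasure fun f => by
    rw [integral_rightMarginal μ f.continuous, h f f.continuous]

lemma mem_meanUniform_of_integral {μ : ProbabilityMeasure IntervalSpace}
    (h : ∀ f : unitInterval → ℝ, Continuous f →
      ∫ s, (f (leftEnd s) + f (rightEnd s)) / 2 ∂(μ : Measure IntervalSpace) = ∫ t, f t) :
    μ ∈ meanUniform := by
  have hfin : IsFiniteMeasure ((2⁻¹ : ENNReal) • (leftMarginal μ + rightMarginal μ)) :=
    Measure.smul_finite _ (by simp)
  refine ext_of_forall_integral_eq_of_IsFiniteMeasure fun f => ?_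
  have hl : Integrable (fun s => f (leftEnd s)) (μ : Measure IntervalSpace) :=
    ((f.integrable (leftMarginal μ)).comp_measurable continuous_leftEnd.measurable)
  have hr : Integrable (fun s => f (rightEnd s)) (μ : Measure IntervalSpace) :=
    ((f.integrable (rightMarginal μ)).comp_measurable continuous_rightEnd.measurable)
  rw [integral_smul_measure, integral_add_measure (f.integrable _) (f.integrable _),
    integral_leftMarginal μ f.continuous, integral_rightMarginal μ f.continuous,
    ← h f f.continuous, integral_div, integral_add hl hr]
  simp [div_eq_inv_mul]

lemma image_leftUniform : limitOf '' leftUniform = intervalGraphLimits := by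
  refine Set.Subset.antisymm ?_ fun Γ hΓ => ?_
  · rintro _ ⟨μ, -, rfl⟩
    exact limitOf_mem_intervalGraphLimits μ
  · obtain ⟨μ, hμ, h⟩ := exists_limitOf_eq hΓ one_pos (fun f s => f (leftEnd s))
      (fun f hf => hf.comp continuous_leftEnd)
      (fun G hG => by simpa using hG.exists_represents_left)
      fun μ h => continuousAt_limitOf_of_mem_leftUniform (mem_leftUniform_of_integral h)
    exact ⟨μ, mem_leftUniform_of_integral h, hμ⟩

lemma image_rightUniform : limitOf '' rightUniform = intervalGraphLimits := by
  refine Set.Subset.antisymm ?_ fun Γ hΓ => ?_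
  · rintro _ ⟨μ, -, rfl⟩
    exact limitOf_mem_intervalGraphLimits μ
  · obtain ⟨μ, hμ, h⟩ := exists_limitOf_eq hΓ one_pos (fun f s => f (rightEnd s))
      (fun f hf => hf.comp continuous_rightEnd)
      (fun G hG => by simpa using hG.exists_represents_right)
      fun μ h => continuousAt_limitOf_of_mem_rightUniform (mem_rightUniform_of_integral h)
    exact ⟨μ, mem_rightUniform_of_integral h, hμ⟩

lemma image_meanUniform : limitOf '' meanUniform = intervalGraphLimits := by
  refine Set.Subset.antisymm ?_ fun Γ hΓ => ?_
  · rintro _ ⟨μ, -, rfl⟩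
    exact limitOf_mem_intervalGraphLimits μ
  · obtain ⟨μ, hμ, h⟩ := exists_limitOf_eq hΓ two_pos
      (fun f s => (f (leftEnd s) + f (rightEnd s)) / 2)
      (fun f hf => ((hf.comp continuous_leftEnd).add (hf.comp continuous_rightEnd)).div_const 2)
      (fun G hG => hG.exists_represents_mean)
      fun μ h => continuousAt_limitOf_of_mem_meanUniform (mem_meanUniform_of_integral h)
    exact ⟨μ, mem_meanUniform_of_integral h, hμ⟩

lemma intervalGraphLimits_eq_range : intervalGraphLimits = Set.range limitOf := by
  refine Set.Subset.antisymm ?_ ?_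
  · rw [← image_leftUniform]
    exact Set.image_subset_range _ _
  · rintro _ ⟨μ, rfl⟩
    exact limitOf_mem_intervalGraphLimits μ

end IntervalGraphLimits

end

theorem theorem3p1 :
    IntervalGraphLimits.intervalGraphLimits = Set.range IntervalGraphLimits.limitOf ∧
    (ContinuousOn IntervalGraphLimits.limitOf IntervalGraphLimits.leftUniform ∧
      IntervalGraphLimits.limitOf '' IntervalGraphLimits.leftUniform =
        IntervalGraphLimits.intervalGraphLimits) ∧
    (ContinuousOn IntervalGraphLimits.limitOf IntervalGraphLimits.rightUniform ∧
      IntervalGraphLimits.limitOf '' IntervalGraphLimits.rightUniform =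
        IntervalGraphLimits.intervalGraphLimits) ∧
    (ContinuousOn IntervalGraphLimits.limitOf IntervalGraphLimits.meanUniform ∧
      IntervalGraphLimits.limitOf '' IntervalGraphLimits.meanUniform =
        IntervalGraphLimits.intervalGraphLimits) :=
  ⟨IntervalGraphLimits.intervalGraphLimits_eq_range,
    ⟨fun _ hμ => (IntervalGraphLimits.continuousAt_limitOf_of_mem_leftUniform
      hμ).continuousWithinAt, IntervalGraphLimits.image_leftUniform⟩,
    ⟨fun _ hμ => (IntervalGraphLimits.continuousAt_limitOf_of_mem_rightUniform
      hμ).continuousWithinAt, IntervalGraphLimits.image_rightUniform⟩,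
    ⟨fun _ hμ => (IntervalGraphLimits.continuousAt_limitOf_of_mem_meanUniform
      hμ).continuousWithinAt, IntervalGraphLimits.image_meanUniform⟩⟩
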